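/- **Setting.** Let $d,T\ge 1$ and $n\ge 0$ be integers, let $\Theta\subseteq\mathbb R^d$ be nonempty and compact with $\ell_\infty$-diameter $D$, let $(P_\theta)_{\theta\in\Theta}$ be probability measures on a measurable space $\mathcal X$, and let $M:\Theta\times\Theta\to\mathbb R$ be a measurable loss. A deterministic estimator is a measurable map $\hat\theta:\mathcal X^n\to\Theta$; $\mathcal D$ is the set of these. The risk is $R(\hat\theta,\theta)=\mathbb E_{X\sim P_\theta^{\otimes n}}[M(\hat\theta(X),\theta)]$; these expectations are assumed to exist. For a probability measure (prior) $P$ on $\Theta$ put $R(\hat\theta,P)=\mathbb E_{\theta\sim P}[R(\hat\theta,\theta)]$. A randomized estimator is a probability measure $\mu$ on $\mathcal D$ (equipped with any $\sigma$-algebra for which every $R(\cdot,\theta)$ is measurable), with risk $R(\mu,\theta)=\mathbb E_{\hat\theta\sim\mu}[R(\hat\theta,\theta)]$, and $R^*=\inf_{\mu}\sup_{\theta\in\Theta}R(\mu,\theta)$ is the minimax risk. Assume that for some $L>0$ $$|R(\hat\theta,\theta_1)-R(\hat\theta,\theta_2)|\le L\|\theta_1-\theta_2\|_1\qquad\text{for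 all }\hat\theta\in\mathcal D,\ \theta_1,\theta_2\in\Theta.$$ **Oracles.** An $(\alpha,\beta)$-approximate maximization oracle maps a finite family $\{\hat\theta_i\}_{i=1}^k$ in $\mathcal D$ ($0\le k\le T$) and $\sigma\in\mathbb R^d$, measurably in $\sigma$, to some $\theta'\in\Theta$ with $$\sum_{i=1}^k R(\hat\theta_i,\theta')+\langle\sigma,\theta'\rangle\ \ge\ \sup_{\theta\in\Theta}\Big(\sum_{i=1}^k R(\hat\theta_i,\theta)+\langle\sigma,\theta\rangle\Big)-(\alpha+\beta\|\sigma\|_1).$$ An $\alpha'$-approximate minimization oracle maps a prior $P$ to some $\hat\theta'\in\mathcal D$ with $R(\hat\theta',P)\le\inf_{\hat\theta\in\mathcal D}R(\hat\theta,P)+\alpha'$. **Algorithm.** Given such oracles and $\eta>0$, for $t=1,\dots,T$: let $P_t$ be the distribution of the output of the maximization oracle on $\{\hat\theta_i\}_{i=1}^{t-1}$ and $\sigma$, where $\sigma\in\mathbb R^d$ has i.i.d. $\mathrm{Exp}(\eta)$ coordinates (i.e. $\Pr(\sigma_j\ge s)=e^{-\eta s}$ for $s\ge0$); let $\hat\theta_t$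 be the output of the minimization oracle on $P_t$. Let $\hat\theta_{\mathrm{rnd}}$ be the randomized estimator sampling uniformly from $\hat\theta_1,\dots,\hat\theta_T$, and $P_{\mathrm{avg}}=\frac1T\sum_{t=1}^T P_t$. **Claim.** There is a universal constant $C>0$ such that, in every such setting, if the algorithm is run with $\eta=(dL^2T)^{-1/2}$, then with $$\epsilon=C\left(D\,d^{3/2}LT^{-1/2}+\alpha+\alpha'+\beta d^{3/2}LT^{1/2}\right)$$ the following hold: 1. $\sup_{\theta\in\Theta}R(\hat\theta_{\mathrm{rnd}},\theta)\le R^*+\epsilon$. 2. $\inf_{\hat\theta\in\mathcal D}R(\hat\theta,P_{\mathrm{avg}})\ge R^*-\epsilon$. 3. If moreover $\Theta$ is convex and $M(\cdot,\theta)$ is convex on $\Theta$ for every $\theta\in\Theta$, then the deterministic estimator $\hat\theta_{\mathrm{avg}}=\frac1T\sum_{t=1}^T\hat\theta_t$ satisfies $\sup_{\theta\in\Theta}R(\hat\theta_{\mathrm{avg}},\theta)\le R^*+\epsilon$ and is an approximate Bayes estimator for $P_{\mathrm{avg}}$: $R(\hat\theta_{\mathrm{avg}},P_{\mathrm{avg}})\le\inf_{\hat\theta\in\mathcal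 D}R(\hat\theta,P_{\mathrm{avg}})+\epsilon$. -/

import Mathlib

open MeasureTheory

noncomputable section

/-- A statistical game: a compact nonempty parameter set `Θ ⊆ ℝ^d`, a family of probability
distributions `(P_θ)` on the sample space `𝒳`, and a measurable loss `M : Θ × Θ → ℝ`
(`loss a θ` is the cost of the estimate `a` when the truth is `θ`; only its values on `Θ × Θ` are
ever used). The data are `n` independent samples from `P_θ`. -/
structure StatGame (d n : ℕ) (𝒳 : Type*) [MeasurableSpace 𝒳] where
  Θ : Set (Fin d → ℝ)
  isCompact : IsCompact Θ
  nonempty : Θ.Nonempty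
  model : Θ → Measure 𝒳
  isProb : ∀ θ, IsProbabilityMeasure (model θ)
  loss : (Fin d → ℝ) → (Fin d → ℝ) → ℝ
  measurable_loss : Measurable (fun p : Θ × Θ => loss p.1 p.2)

namespace StatGame

variable {d n : ℕ} {𝒳 : Type*} [MeasurableSpace 𝒳]

/-- Deterministic estimators: measurable maps `𝒳^n → Θ`. -/
structure Estimator (G : StatGame d n 𝒳) where
  toFun : (Fin n → 𝒳) → G.Θ
  measurable_toFun : Measurable toFun

/-- The law of `n` independent samples from `P_θ`. -/
def sampleLaw (G : StatGame d n 𝒳) (θ : G.Θ) : Measure (Fin n → 𝒳) :=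
  Measure.pi (fun _ => G.model θ)

/-- The risk `R(e, θ) = E[M(e(X₁, …, Xₙ), θ)]` of a deterministic estimator. -/
def risk (G : StatGame d n 𝒳) (e : G.Estimator) (θ : G.Θ) : ℝ :=
  ∫ x, G.loss (e.toFun x) θ ∂(G.sampleLaw θ)

/-- The expectations defining the risks of deterministic estimators exist. -/
def HasRisk (G : StatGame d n 𝒳) : Prop :=
  ∀ (e : G.Estimator) (θ : G.Θ), Integrable (fun x => G.loss (e.toFun x) θ) (G.sampleLaw θ)

/-- The risk is `L`-Lipschitz in the parameter with respect to the `ℓ₁` norm. -/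
def RiskLipschitz (G : StatGame d n 𝒳) (L : ℝ) : Prop :=
  ∀ (e : G.Estimator) (θ₁ θ₂ : G.Θ),
    |G.risk e θ₁ - G.risk e θ₂| ≤ L * ∑ j, |(θ₁ : Fin d → ℝ) j - (θ₂ : Fin d → ℝ) j|

/-- The integrated risk `R(e, P) = E_{θ ∼ P} R(e, θ)` under the prior `P`. -/
def bayesRisk (G : StatGame d n 𝒳) (e : G.Estimator) (P : Measure G.Θ) : ℝ :=
  ∫ θ, G.risk e θ ∂P

/-- The risk `R(μ, θ) = E_{e ∼ μ} R(e, θ)` of the randomized estimator `μ`, a probability measure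
on the set of deterministic estimators, as an extended real: the integral of the positive part
minus that of the negative part. -/
def randRisk (G : StatGame d n 𝒳) [MeasurableSpace G.Estimator]
    (μ : Measure G.Estimator) (θ : G.Θ) : EReal :=
  ((∫⁻ e, ENNReal.ofReal (G.risk e θ) ∂μ : ENNReal) : EReal) -
    ((∫⁻ e, ENNReal.ofReal (-(G.risk e θ)) ∂μ : ENNReal) : EReal)

/-- The minimax risk `R* = inf_μ sup_θ R(μ, θ)`, over all randomized estimators `μ`. -/
def minimaxRisk (G : StatGame d n 𝒳) [MeasurableSpace G.Estimator] : EReal :=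
  ⨅ μ : ProbabilityMeasure G.Estimator, ⨆ θ : G.Θ, G.randRisk (μ : Measure G.Estimator) θ

/-- The objective `∑ i, R(e_i, θ) + ⟨σ, θ⟩` of the maximization player. -/
def perturbedRisk (G : StatGame d n 𝒳) (l : List G.Estimator) (σ : Fin d → ℝ) (θ : G.Θ) : ℝ :=
  (l.map (fun e => G.risk e θ)).sum + ∑ j, σ j * (θ : Fin d → ℝ) j

/-- `O` is an `(α, β)`-approximate maximization oracle on families of at most `N` estimators: its
output depends measurably on the perturbation `σ`, and its value is within `α + β ‖σ‖₁` of the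
supremum of the perturbed risk. -/
def IsMaxOracle (G : StatGame d n 𝒳) (α β : ℝ) (N : ℕ)
    (O : List G.Estimator → (Fin d → ℝ) → G.Θ) : Prop :=
  ∀ l : List G.Estimator, l.length ≤ N →
    Measurable (O l) ∧
    ∀ (σ : Fin d → ℝ) (θ : G.Θ),
      G.perturbedRisk l σ θ - (α + β * ∑ j, |σ j|) ≤ G.perturbedRisk l σ (O l σ)

/-- `O` is an `α'`-approximate minimization oracle: for every prior `P`, the integrated risk of
`O P` is within `α'` of the infimum over all deterministic estimators. -/
def IsMinOracle (G : StatGame d n 𝒳) (α' : ℝ) (O : Measure G.Θ → G.Estimator) : Prop :=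
  ∀ P : Measure G.Θ, IsProbabilityMeasure P →
    ∀ e : G.Estimator, G.bayesRisk (O P) P ≤ G.bayesRisk e P + α'

/-- The law of a vector in `ℝ^d` with i.i.d. exponential coordinates of rate `η`. -/
def noiseLaw (d : ℕ) (η : ℝ) : Measure (Fin d → ℝ) :=
  Measure.pi (fun _ => ProbabilityTheory.expMeasure η)

section Algorithm

variable (G : StatGame d n 𝒳) (maxO : List G.Estimator → (Fin d → ℝ) → G.Θ)
  (minO : Measure G.Θ → G.Estimator) (η : ℝ)

/-- The estimators chosen by the minimization player in the first `t` rounds of follow the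
perturbed leader against (approximate) best response. -/
def history : ℕ → List G.Estimator
  | 0 => []
  | t + 1 => history t ++ [minO (Measure.map (maxO (history t)) (noiseLaw d η))]

/-- The prior chosen in round `t + 1`: the law of `maxO {e_1, …, e_t} σ` for exponential `σ`. -/
def prior (t : ℕ) : Measure G.Θ :=
  Measure.map (maxO (G.history maxO minO η t)) (noiseLaw d η)

/-- The estimator chosen in round `t + 1`. -/
def iterate (t : ℕ) : G.Estimator :=
  minO (G.prior maxO minO η t)

/-- The average prior `(P_1 + ⋯ + P_T) / T`. -/
def avgPrior (T : ℕ) : Measure G.Θ :=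
  (T : ENNReal)⁻¹ • ∑ t ∈ Finset.range T, G.prior maxO minO η t

/-- The randomized estimator that samples uniformly from the `T` iterates. -/
def rndEstimator [MeasurableSpace G.Estimator] (T : ℕ) : Measure G.Estimator :=
  (T : ENNReal)⁻¹ • ∑ t ∈ Finset.range T, Measure.dirac (G.iterate maxO minO η t)

/-- The deterministic estimator `x ↦ (e_1(x) + ⋯ + e_T(x)) / T`, the mean of the randomized one.
It takes values in `Θ` because `Θ` is convex. -/
def avgEstimator (hΘ : Convex ℝ G.Θ) (T : ℕ) (hT : 0 < T) : G.Estimator where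
  toFun x := ⟨∑ t ∈ Finset.range T,
      (T : ℝ)⁻¹ • ((G.iterate maxO minO η t).toFun x : Fin d → ℝ), by
    refine hΘ.sum_mem (fun _ _ => by positivity) ?_ (fun t _ => Subtype.coe_prop _)
    have : (T : ℝ) ≠ 0 := by positivity
    simp [this]⟩
  measurable_toFun := by
    refine Measurable.subtype_mk ?_
    refine Finset.measurable_sum _ fun t _ => ?_
    have h : Measurable fun x => ((G.iterate maxO minO η t).toFun x : Fin d → ℝ) :=
      measurable_subtype_coe.comp (G.iterate maxO minO η t).measurable_toFun
    exact h.const_smul (T : ℝ)⁻¹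

end Algorithm

end StatGame

end

/-! The algorithm plays the game with payoff `R(e, θ)` repeatedly: the `θ`-player follows the
perturbed leader and the estimator player answers with an approximate best response. If the average
regret of the `θ`-player is at most `r` and `v` is the average payoff, then `v - α'` bounds every
Bayes risk under the average prior from below, while `v + r` bounds the worst-case risk of the
averaged estimator from above, so that `R*` and both players' guarantees lie within `r + α'` of one
another.

The regret is controlled by adding one round at a time. Between consecutive rounds the leader hardly
moves: shifting coordinate `i` of the perturbation by `c` lifts that coordinate of both leaders
above the two unshifted ones, up to an error of order `1 / c`, while the law of exponential noise is
shifted at the cost of a factor `exp (η c)` in density. Integrating with `c` of order `L d` bounds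
the expected displacement by itself, with a factor less than one, plus the error. -/

/-- `x` maximizes `f` up to the error `γ`. -/
def IsApproxMax {X : Type*} (f : X → ℝ) (γ : ℝ) (x : X) : Prop :=
  ∀ y, f y ≤ f x + γ

theorem IsApproxMax.error_nonneg {X : Type*} {f : X → ℝ} {γ : ℝ} {x : X}
    (h : IsApproxMax f γ x) : 0 ≤ γ := by
  linarith [h x]

theorem IsApproxMax.max_le_min_add {X : Type*} {F g u : X → ℝ} {c γ γ' : ℝ} {x y x' y' : X}
    (hc : 0 < c) (hx : IsApproxMax F γ x) (hy : IsApproxMax (F + g) γ y)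
    (hx' : IsApproxMax (F + c • u) γ' x') (hy' : IsApproxMax (F + g + c • u) γ' y') :
    max (u x) (u y) ≤ min (u x') (u y') + (|g x - g y| + 2 * γ + γ') / c := by
  simp only [IsApproxMax, Pi.add_apply, Pi.smul_apply, smul_eq_mul] at hx hy hx' hy'
  have hγ : 0 ≤ γ := by linarith [hx x]
  have hg := abs_le.1 (le_refl |g x - g y|)
  have of_mul_sub_le {a b : ℝ} (h : c * a - c * b ≤ |g x - g y| + 2 * γ + γ') :
      a ≤ b + (|g x - g y| + 2 * γ + γ') / c := by
    rw [← sub_le_iff_le_add', le_div_iff₀ hc]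
    linarith
  rw [← min_add_add_right]
  refine max_le (le_min ?_ ?_) (le_min ?_ ?_) <;> refine of_mul_sub_le ?_
  · linarith [hx x', hx' x]
  · linarith [hx y, hy y', hy' x]
  · linarith [hx x', hy x, hx' y]
  · linarith [hy y', hy' y]

/-- The be-the-leader inequality for approximate leaders, with `r` as a regularizer. -/
theorem IsApproxMax.add_sum_le_add_sum_succ {X : Type*} {r : X → ℝ} {f : ℕ → X → ℝ} {x : ℕ → X}
    {γ : ℝ} {N : ℕ} (hx : ∀ t ≤ N, IsApproxMax (fun y => r y + ∑ s ∈ Finset.range t, f s y) γ (x t))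
    (y : X) :
    r y + ∑ t ∈ Finset.range N, f t y ≤
      r (x 0) + ∑ t ∈ Finset.range N, f t (x (t + 1)) + (N + 1) * γ := by
  induction N generalizing y with
  | zero => simpa using hx 0 le_rfl y
  | succ N ih =>
    have hleader := hx (N + 1) le_rfl y
    have hprev := ih (fun t ht => hx t (ht.trans N.le_succ)) (x (N + 1))
    simp only [Finset.sum_range_succ] at hleader ⊢
    push_cast
    linarith

section EllOne

variable {d : ℕ} {L : ℝ}

/-- The `ℓ₁` norm on `ℝ^d`; the norm of the type `Fin d → ℝ` is the sup norm. -/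
noncomputable def ell1Norm (v : Fin d → ℝ) : ℝ :=
  ∑ j, |v j|

theorem ell1Norm_nonneg (v : Fin d → ℝ) : 0 ≤ ell1Norm v :=
  Finset.sum_nonneg fun _ _ => abs_nonneg _

theorem ell1Norm_add_le (v w : Fin d → ℝ) : ell1Norm (v + w) ≤ ell1Norm v + ell1Norm w := by
  rw [ell1Norm, ell1Norm, ell1Norm, ← Finset.sum_add_distrib]
  exact Finset.sum_le_sum fun j _ => abs_add_le _ _

theorem ell1Norm_single (i : Fin d) (c : ℝ) : ell1Norm (Pi.single i c) = |c| := by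
  simp [ell1Norm, Pi.single_apply, apply_ite abs]

theorem ell1Norm_le_mul_norm (v : Fin d → ℝ) : ell1Norm v ≤ d * ‖v‖ := by
  simpa [ell1Norm] using Finset.sum_le_card_nsmul Finset.univ (fun j => |v j|) ‖v‖
    fun j _ => norm_le_pi_norm v j

theorem dotProduct_le_norm_mul_ell1Norm (v w : Fin d → ℝ) : v ⬝ᵥ w ≤ ‖w‖ * ell1Norm v := by
  rw [dotProduct, ell1Norm, Finset.mul_sum]
  refine Finset.sum_le_sum fun j _ => (le_abs_self _).trans ?_
  rw [abs_mul, mul_comm]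
  exact mul_le_mul_of_nonneg_right (norm_le_pi_norm w j) (abs_nonneg _)

/-- `f : Θ → ℝ` is `L`-Lipschitz for the `ℓ₁` distance, whereas `LipschitzWith` refers to the sup
distance on `Θ ⊆ ℝ^d`. -/
def IsEll1Lipschitz {Θ : Set (Fin d → ℝ)} (L : ℝ) (f : Θ → ℝ) : Prop :=
  ∀ θ₁ θ₂ : Θ, |f θ₁ - f θ₂| ≤ L * ell1Norm ((θ₁ : Fin d → ℝ) - (θ₂ : Fin d → ℝ))

variable {Θ : Set (Fin d → ℝ)}

theorem IsEll1Lipschitz.lipschitzWith {f : Θ → ℝ} (hf : IsEll1Lipschitz L f) :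
    LipschitzWith (‖L‖₊ * d) f := by
  refine LipschitzWith.of_dist_le_mul fun θ₁ θ₂ => ?_
  calc dist (f θ₁) (f θ₂)
      ≤ L * ell1Norm ((θ₁ : Fin d → ℝ) - (θ₂ : Fin d → ℝ)) := hf θ₁ θ₂
    _ ≤ ‖L‖ * (d * ‖(θ₁ : Fin d → ℝ) - (θ₂ : Fin d → ℝ)‖) :=
        mul_le_mul (Real.le_norm_self L) (ell1Norm_le_mul_norm _) (ell1Norm_nonneg _)
          (norm_nonneg L)
    _ = (‖L‖₊ * d : NNReal) * dist θ₁ θ₂ := by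
        rw [Subtype.dist_eq, dist_eq_norm, NNReal.coe_mul, coe_nnnorm, NNReal.coe_natCast,
          mul_assoc]

theorem IsEll1Lipschitz.integrable {f : Θ → ℝ} (hf : IsEll1Lipschitz L f)
    (hΘ : Bornology.IsBounded Θ) (P : Measure Θ) [IsFiniteMeasure P] : Integrable f P := by
  have : BoundedSpace Θ := boundedSpace_subtype_iff.2 hΘ
  have hbdd := hf.lipschitzWith.isBounded_image (Bornology.IsBounded.all Set.univ)
  obtain ⟨b, hb⟩ := hbdd.exists_norm_le
  exact Integrable.of_bound hf.lipschitzWith.continuous.aestronglyMeasurable b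
    (ae_of_all _ fun θ => hb _ ⟨θ, Set.mem_univ θ, rfl⟩)

theorem exists_coord_mem_Icc (hΘ : Bornology.IsBounded Θ) (j : Fin d) :
    ∃ a : ℝ, ∀ θ : Θ, (θ : Fin d → ℝ) j ∈ Set.Icc a (a + Metric.diam Θ) := by
  have hlip : LipschitzWith 1 (Function.eval j : (Fin d → ℝ) → ℝ) := LipschitzWith.eval j
  have hbdd := hlip.isBounded_image hΘ
  have hdiam : Metric.diam (Function.eval j '' Θ) ≤ Metric.diam Θ := by
    simpa using hlip.diam_image_le Θ hΘ
  rw [Real.diam_eq hbdd] at hdiam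
  refine ⟨sInf (Function.eval j '' Θ), fun θ => ?_⟩
  have hmem := hbdd.subset_Icc_sInf_sSup ⟨θ, θ.2, rfl⟩
  exact ⟨hmem.1, hmem.2.trans (by linarith)⟩

end EllOne

theorem le_pi_of_forall_univ_pi_le {ι : Type*} [Fintype ι] {X : ι → Type*}
    [∀ i, MeasurableSpace (X i)] {μ : ∀ i, Measure (X i)} {ν : Measure (∀ i, X i)}
    (h : ∀ s : ∀ i, Set (X i), (∀ i, MeasurableSet (s i)) →
      ν (Set.univ.pi s) ≤ ∏ i, μ i (s i)) :
    ν ≤ Measure.pi μ := by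
  have houter : ν.toOuterMeasure ≤ OuterMeasure.pi fun i => (μ i).toOuterMeasure := by
    rw [OuterMeasure.le_pi]
    intro s _
    calc ν (Set.univ.pi s)
        ≤ ν (Set.univ.pi fun i => toMeasurable (μ i) (s i)) :=
          measure_mono (Set.pi_mono fun i _ => subset_toMeasurable _ _)
      _ ≤ ∏ i, μ i (toMeasurable (μ i) (s i)) := h _ fun i => measurableSet_toMeasurable _ _
      _ = ∏ i, μ i (s i) := by simp only [measure_toMeasurable]
  refine Measure.le_iff.2 fun s hs => ?_
  rw [Measure.pi, toMeasure_apply _ _ hs]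
  exact houter s

section Average

variable {Ω : Type*} [MeasurableSpace Ω] {P : ℕ → Measure Ω} {T : ℕ}

theorem isProbabilityMeasure_inv_smul_sum_range (hT : 0 < T)
    (hP : ∀ t < T, IsProbabilityMeasure (P t)) :
    IsProbabilityMeasure ((T : ENNReal)⁻¹ • ∑ t ∈ Finset.range T, P t) := by
  constructor
  rw [Measure.smul_apply, Measure.finsetSum_apply,
    Finset.sum_congr rfl fun t ht => (hP t (Finset.mem_range.1 ht)).measure_univ]
  simpa using ENNReal.inv_mul_cancel (by exact_mod_cast hT.ne') (ENNReal.natCast_ne_top T)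

theorem integral_inv_smul_sum_range {f : Ω → ℝ} (hf : ∀ t < T, Integrable f (P t)) :
    ∫ ω, f ω ∂((T : ENNReal)⁻¹ • ∑ t ∈ Finset.range T, P t) =
      (T : ℝ)⁻¹ * ∑ t ∈ Finset.range T, ∫ ω, f ω ∂(P t) := by
  rw [integral_smul_measure,
    integral_finsetSum_measure fun t ht => hf t (Finset.mem_range.1 ht)]
  simp

end Average

section Exponential

open ProbabilityTheory

theorem ofReal_exp_mul_exponentialPDF_sub_le {c : ℝ} (hc : 0 ≤ c) (η x : ℝ) :
    ENNReal.ofReal (Real.exp (-(η * c))) * exponentialPDF η (x - c) ≤ exponentialPDF η x := by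
  rcases lt_or_ge (x - c) 0 with h | h
  · simp [exponentialPDF_of_neg h]
  · rw [exponentialPDF_of_nonneg h, exponentialPDF_of_nonneg (by linarith),
      ← ENNReal.ofReal_mul (Real.exp_pos _).le, mul_left_comm, ← Real.exp_add]
    ring_nf
    exact le_rfl

theorem ofReal_exp_smul_map_add_expMeasure_le {c : ℝ} (hc : 0 ≤ c) (η : ℝ) :
    ENNReal.ofReal (Real.exp (-(η * c))) • (expMeasure η).map (· + c) ≤ expMeasure η := by
  refine Measure.le_iff.2 fun s hs => ?_
  have hpre : MeasurableSet ((· + c) ⁻¹' s) := hs.preimage (measurable_add_const c)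
  rw [Measure.smul_apply, Measure.map_apply (measurable_add_const c) hs, smul_eq_mul]
  change _ * (volume.withDensity (exponentialPDF η)) _ ≤ (volume.withDensity (exponentialPDF η)) s
  rw [withDensity_apply _ hpre, withDensity_apply _ hs, ← lintegral_indicator hpre,
    ← lintegral_indicator hs, ← lintegral_sub_right_eq_self _ c,
    ← lintegral_const_mul' _ _ ENNReal.ofReal_ne_top]
  refine lintegral_mono fun x => ?_
  by_cases hx : x ∈ s
  · simpa [hx] using ofReal_exp_mul_exponentialPDF_sub_le hc η x
  · simp [hx]

theorem lintegral_abs_expMeasure {η : ℝ} (hη : 0 < η) :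
    ∫⁻ x, ENNReal.ofReal |x| ∂(expMeasure η) = ENNReal.ofReal (1 / η) := by
  have hgamma (x : ℝ) : gammaPDF 1 η x * ENNReal.ofReal |x| =
      ENNReal.ofReal (1 / η) * gammaPDF 2 η x := by
    rcases lt_or_ge x 0 with hx | hx
    · simp [gammaPDF_of_neg hx]
    · rw [gammaPDF_of_nonneg hx, gammaPDF_of_nonneg hx, ← ENNReal.ofReal_mul (by positivity),
        ← ENNReal.ofReal_mul (by positivity), abs_of_nonneg hx]
      congr 1
      norm_num
      field_simp
  have hmeas (k : ℝ) : Measurable (gammaPDF k η) := (measurable_gammaPDFReal k η).ennreal_ofReal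
  calc ∫⁻ x, ENNReal.ofReal |x| ∂(expMeasure η)
      = ∫⁻ x, gammaPDF 1 η x * ENNReal.ofReal |x| :=
        lintegral_withDensity_eq_lintegral_mul _ (hmeas 1) (by fun_prop)
    _ = ENNReal.ofReal (1 / η) := by
        rw [lintegral_congr hgamma, lintegral_const_mul _ (hmeas 2),
          lintegral_gammaPDF_eq_one two_pos hη, mul_one]

theorem integrable_abs_expMeasure {η : ℝ} (hη : 0 < η) :
    Integrable (fun x : ℝ => |x|) (expMeasure η) := by
  refine ⟨by fun_prop, ?_⟩
  rw [hasFiniteIntegral_iff_ofReal (ae_of_all _ fun x => abs_nonneg x), lintegral_abs_expMeasure hη]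
  exact ENNReal.ofReal_lt_top

theorem integral_abs_expMeasure {η : ℝ} (hη : 0 < η) :
    ∫ x, |x| ∂(expMeasure η) = 1 / η := by
  rw [integral_eq_lintegral_of_nonneg_ae (ae_of_all _ fun x => abs_nonneg x) (by fun_prop),
    lintegral_abs_expMeasure hη, ENNReal.toReal_ofReal (by positivity)]

end Exponential

namespace StatGame

section Noise

open ProbabilityTheory

variable {d : ℕ} {η : ℝ}

theorem isProbabilityMeasure_noiseLaw (d : ℕ) (hη : 0 < η) :
    IsProbabilityMeasure (noiseLaw d η) := by
  have := isProbabilityMeasure_expMeasure hη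
  unfold noiseLaw
  infer_instance

theorem integrable_ell1Norm_noiseLaw (hη : 0 < η) :
    Integrable (fun σ : Fin d → ℝ => ell1Norm σ) (noiseLaw d η) := by
  have := isProbabilityMeasure_expMeasure hη
  exact integrable_finsetSum _ fun j _ => integrable_comp_eval (integrable_abs_expMeasure hη)

theorem integral_ell1Norm_noiseLaw (hη : 0 < η) :
    ∫ σ : Fin d → ℝ, ell1Norm σ ∂(noiseLaw d η) = d / η := by
  have := isProbabilityMeasure_expMeasure hη
  have hcoord (j : Fin d) : ∫ σ, |σ j| ∂(Measure.pi fun _ => expMeasure η) = 1 / η :=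
    (integral_comp_eval (μ := fun _ : Fin d => expMeasure η) (f := fun x : ℝ => |x|)
      (by fun_prop)).trans (integral_abs_expMeasure hη)
  unfold ell1Norm noiseLaw
  rw [integral_finsetSum _ fun j _ => integrable_comp_eval (integrable_abs_expMeasure hη)]
  simp [hcoord, div_eq_mul_inv]

theorem integrable_add_mul_ell1Norm_noiseLaw (hη : 0 < η) (α β : ℝ) :
    Integrable (fun σ : Fin d → ℝ => α + β * ell1Norm σ) (noiseLaw d η) := by
  have := isProbabilityMeasure_noiseLaw d hη
  exact (integrable_const α).add ((integrable_ell1Norm_noiseLaw hη).const_mul β)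

theorem integral_add_mul_ell1Norm_noiseLaw (hη : 0 < η) (α β : ℝ) :
    ∫ σ : Fin d → ℝ, α + β * ell1Norm σ ∂(noiseLaw d η) = α + β * (d / η) := by
  have := isProbabilityMeasure_noiseLaw d hη
  rw [integral_add (integrable_const α) ((integrable_ell1Norm_noiseLaw hη).const_mul β),
    integral_const_mul, integral_ell1Norm_noiseLaw hη]
  simp

theorem ofReal_exp_smul_map_add_single_noiseLaw_le {c : ℝ} (hη : 0 < η) (hc : 0 ≤ c) (i : Fin d) :
    ENNReal.ofReal (Real.exp (-(η * c))) • (noiseLaw d η).map (· + Pi.single i c) ≤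
      noiseLaw d η := by
  have := isProbabilityMeasure_expMeasure hη
  refine le_pi_of_forall_univ_pi_le fun s hs => ?_
  have hpre : (· + Pi.single i c) ⁻¹' Set.univ.pi s =
      Set.univ.pi fun j => (· + (Pi.single i c : Fin d → ℝ) j) ⁻¹' s j := by
    ext σ; simp
  have hprod : ENNReal.ofReal (Real.exp (-(η * c))) =
      ∏ j, if j = i then ENNReal.ofReal (Real.exp (-(η * c))) else 1 := by simp
  rw [Measure.smul_apply, Measure.map_apply (by fun_prop) (MeasurableSet.univ_pi hs), hpre,
    noiseLaw, Measure.pi_pi, smul_eq_mul, hprod, ← Finset.prod_mul_distrib]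
  refine Finset.prod_le_prod' fun j _ => ?_
  by_cases hj : j = i
  · subst hj
    have hshift := ofReal_exp_smul_map_add_expMeasure_le hc η (s j)
    rw [Measure.smul_apply, Measure.map_apply (measurable_add_const c) (hs j)] at hshift
    simpa using hshift
  · simp [hj]

theorem integrable_noiseLaw_of_mem_Icc {a b : ℝ} (hη : 0 < η) {u : (Fin d → ℝ) → ℝ}
    (hu : Measurable u) (h : ∀ σ, u σ ∈ Set.Icc a b) : Integrable u (noiseLaw d η) := by
  have := isProbabilityMeasure_noiseLaw d hη
  exact Integrable.of_mem_Icc a b hu.aemeasurable (ae_of_all _ h)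

theorem integral_add_single_noiseLaw_le {c a D : ℝ} (hη : 0 < η) (hc : 0 ≤ c) (i : Fin d)
    {u : (Fin d → ℝ) → ℝ} (hu : Measurable u) (hmem : ∀ σ, u σ ∈ Set.Icc a (a + D)) :
    ∫ σ, u (σ + Pi.single i c) ∂(noiseLaw d η) ≤ ∫ σ, u σ ∂(noiseLaw d η) + η * c * D := by
  have := isProbabilityMeasure_noiseLaw d hη
  have hτ : Measurable fun σ : Fin d → ℝ => σ + Pi.single i c := by fun_prop
  have hint := integrable_noiseLaw_of_mem_Icc hη hu hmem
  have hint' : Integrable (fun σ => u (σ + Pi.single i c)) (noiseLaw d η) :=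
    integrable_noiseLaw_of_mem_Icc hη (hu.comp hτ) fun σ => hmem _
  set I := ∫ σ, u σ ∂(noiseLaw d η)
  set I' := ∫ σ, u (σ + Pi.single i c) ∂(noiseLaw d η)
  have hmono : Real.exp (-(η * c)) * (I' - a) ≤ I - a := by
    have h := integral_mono_measure (ofReal_exp_smul_map_add_single_noiseLaw_le hη hc i)
      (f := fun σ => u σ - a) (ae_of_all _ fun σ => sub_nonneg.2 (hmem σ).1)
      (hint.sub (integrable_const a))
    rw [integral_smul_measure, integral_map hτ.aemeasurable (hu.sub_const a).aestronglyMeasurable,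
      ENNReal.toReal_ofReal (Real.exp_pos _).le, integral_sub hint (integrable_const a),
      integral_sub hint' (integrable_const a)] at h
    simpa using h
  have hupper : I' ≤ a + D := by
    simpa using integral_mono hint' (integrable_const (a + D)) fun σ => (hmem _).2
  have hlower : a ≤ I' := by
    simpa using integral_mono (integrable_const a) hint' fun σ => (hmem _).1
  calc I' = (1 - η * c) * (I' - a) + η * c * (I' - a) + a := by ring
    _ ≤ Real.exp (-(η * c)) * (I' - a) + η * c * D + a := by
        gcongr
        · exact Real.one_sub_le_exp_neg _
        · linarith
    _ ≤ I + η * c * D := by linarith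

theorem integral_abs_sub_noiseLaw_le {c a D : ℝ} (hη : 0 < η) (hc : 0 ≤ c) (i : Fin d)
    {u v E : (Fin d → ℝ) → ℝ} (hu : Measurable u) (hv : Measurable v)
    (humem : ∀ σ, u σ ∈ Set.Icc a (a + D)) (hvmem : ∀ σ, v σ ∈ Set.Icc a (a + D))
    (hE : Integrable E (noiseLaw d η))
    (hshift : ∀ σ, max (u σ) (v σ) ≤
      min (u (σ + Pi.single i c)) (v (σ + Pi.single i c)) + E σ) :
    ∫ σ, |u σ - v σ| ∂(noiseLaw d η) ≤ η * c * D + ∫ σ, E σ ∂(noiseLaw d η) := by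
  set m : (Fin d → ℝ) → ℝ := fun σ => min (u σ) (v σ)
  have hm : Measurable m := hu.min hv
  have hmem (σ) : m σ ∈ Set.Icc a (a + D) :=
    ⟨le_min (humem σ).1 (hvmem σ).1, (min_le_left _ _).trans (humem σ).2⟩
  have hint := integrable_noiseLaw_of_mem_Icc hη hm hmem
  have hint' : Integrable (fun σ => m (σ + Pi.single i c)) (noiseLaw d η) :=
    integrable_noiseLaw_of_mem_Icc hη (hm.comp (by fun_prop)) fun σ => hmem _
  have hsub := (integrable_noiseLaw_of_mem_Icc hη hu humem).sub
    (integrable_noiseLaw_of_mem_Icc hη hv hvmem)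
  calc ∫ σ, |u σ - v σ| ∂(noiseLaw d η)
      ≤ ∫ σ, (m (σ + Pi.single i c) - m σ) + E σ ∂(noiseLaw d η) := by
        refine integral_mono hsub.abs ((hint'.sub hint).add hE) fun σ => ?_
        change |u σ - v σ| ≤ m (σ + Pi.single i c) - min (u σ) (v σ) + E σ
        linarith [hshift σ, max_sub_min_eq_abs' (u σ) (v σ)]
    _ = ∫ σ, m (σ + Pi.single i c) ∂(noiseLaw d η) - ∫ σ, m σ ∂(noiseLaw d η) +
          ∫ σ, E σ ∂(noiseLaw d η) := by
        rw [integral_add (hint'.sub' hint) hE, integral_sub hint' hint]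
    _ ≤ η * c * D + ∫ σ, E σ ∂(noiseLaw d η) := by
        linarith [integral_add_single_noiseLaw_le hη hc i hm hmem]

end Noise

section PerturbedLeader

variable {d : ℕ} {Θ : Set (Fin d → ℝ)} {F g : Θ → ℝ} {L α β η : ℝ} {x y : (Fin d → ℝ) → Θ}

/-- `x σ` is the approximate leader for the payoff `F` under the linear perturbation `σ`. The error
may grow with `‖σ‖₁`, as for the maximization oracle. -/
structure IsPerturbedLeader (F : Θ → ℝ) (α β : ℝ) (x : (Fin d → ℝ) → Θ) : Prop where
  measurable : Measurable x
  isApproxMax : ∀ σ,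
    IsApproxMax (fun θ => F θ + σ ⬝ᵥ (θ : Fin d → ℝ)) (α + β * ell1Norm σ) (x σ)

theorem IsPerturbedLeader.alpha_nonneg (hx : IsPerturbedLeader F α β x) : 0 ≤ α := by
  simpa [ell1Norm] using (hx.isApproxMax 0).error_nonneg

theorem IsPerturbedLeader.beta_nonneg (hd : 0 < d) (hx : IsPerturbedLeader F α β x) : 0 ≤ β := by
  by_contra! hβ
  have hpos : 0 < (α + 1) / -β := div_pos (by linarith [hx.alpha_nonneg]) (by linarith)
  have h := (hx.isApproxMax (Pi.single ⟨0, hd⟩ ((α + 1) / -β))).error_nonneg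
  rw [ell1Norm_single, abs_of_pos hpos, mul_div_assoc', div_neg, mul_div_cancel_left₀ _ hβ.ne] at h
  linarith

theorem IsPerturbedLeader.measurable_coord (hx : IsPerturbedLeader F α β x) (j : Fin d) :
    Measurable fun σ => (x σ : Fin d → ℝ) j :=
  (measurable_pi_apply j).comp (measurable_subtype_coe.comp hx.measurable)

theorem IsPerturbedLeader.max_coord_le_min_coord_add_single {c : ℝ} (hc : 0 < c) (hβ : 0 ≤ β)
    (hg : IsEll1Lipschitz L g) (hx : IsPerturbedLeader F α β x)
    (hy : IsPerturbedLeader (F + g) α β y) (i : Fin d) (σ : Fin d → ℝ) :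
    max ((x σ : Fin d → ℝ) i) ((y σ : Fin d → ℝ) i) ≤
      min ((x (σ + Pi.single i c) : Fin d → ℝ) i) ((y (σ + Pi.single i c) : Fin d → ℝ) i) +
        (L * ell1Norm ((x σ : Fin d → ℝ) - (y σ : Fin d → ℝ)) + 3 * (α + β * ell1Norm σ) +
          β * c) / c := by
  set φ : Θ → ℝ := fun θ => F θ + σ ⬝ᵥ (θ : Fin d → ℝ)
  set u : Θ → ℝ := fun θ => (θ : Fin d → ℝ) i
  have hy₀ : IsApproxMax (φ + g) (α + β * ell1Norm σ) (y σ) := by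
    convert hy.isApproxMax σ using 1
    ext θ
    simp only [φ, Pi.add_apply]
    ring
  have hx₁ : IsApproxMax (φ + c • u) (α + β * ell1Norm (σ + Pi.single i c))
      (x (σ + Pi.single i c)) := by
    convert hx.isApproxMax (σ + Pi.single i c) using 1
    ext θ
    simp [φ, u, add_dotProduct, add_assoc]
  have hy₁ : IsApproxMax (φ + g + c • u) (α + β * ell1Norm (σ + Pi.single i c))
      (y (σ + Pi.single i c)) := by
    convert hy.isApproxMax (σ + Pi.single i c) using 1
    ext θ
    simp [φ, u, add_dotProduct]
    ring
  refine (IsApproxMax.max_le_min_add hc (hx.isApproxMax σ) hy₀ hx₁ hy₁).trans ?_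
  have herror : β * ell1Norm (σ + Pi.single i c) ≤ β * (ell1Norm σ + c) := by
    have := ell1Norm_add_le σ (Pi.single i c)
    rw [ell1Norm_single, abs_of_pos hc] at this
    gcongr
  refine add_le_add_right (div_le_div_of_nonneg_right ?_ hc.le) _
  linarith [hg (x σ) (y σ)]

theorem IsPerturbedLeader.integrable_abs_coord_sub {F' : Θ → ℝ} (hΘ : Bornology.IsBounded Θ)
    (hη : 0 < η) (hx : IsPerturbedLeader F α β x) (hy : IsPerturbedLeader F' α β y) (i : Fin d) :
    Integrable (fun σ => |(x σ : Fin d → ℝ) i - (y σ : Fin d → ℝ) i|) (noiseLaw d η) := by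
  obtain ⟨a, ha⟩ := exists_coord_mem_Icc hΘ i
  exact ((integrable_noiseLaw_of_mem_Icc hη (hx.measurable_coord i) fun σ => ha (x σ)).sub
    (integrable_noiseLaw_of_mem_Icc hη (hy.measurable_coord i) fun σ => ha (y σ))).abs

theorem IsPerturbedLeader.integrable_ell1Norm_sub {F' : Θ → ℝ} (hΘ : Bornology.IsBounded Θ)
    (hη : 0 < η) (hx : IsPerturbedLeader F α β x) (hy : IsPerturbedLeader F' α β y) :
    Integrable (fun σ => ell1Norm ((x σ : Fin d → ℝ) - (y σ : Fin d → ℝ))) (noiseLaw d η) :=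
  integrable_finsetSum _ fun i _ => hx.integrable_abs_coord_sub hΘ hη hy i

theorem IsPerturbedLeader.integral_abs_coord_sub_le {c : ℝ} (hd : 0 < d) (hc : 0 < c)
    (hΘ : Bornology.IsBounded Θ) (hη : 0 < η) (hg : IsEll1Lipschitz L g)
    (hx : IsPerturbedLeader F α β x) (hy : IsPerturbedLeader (F + g) α β y) (i : Fin d) :
    ∫ σ, |(x σ : Fin d → ℝ) i - (y σ : Fin d → ℝ) i| ∂(noiseLaw d η) ≤
      η * c * Metric.diam Θ +
        (L * ∫ σ, ell1Norm ((x σ : Fin d → ℝ) - (y σ : Fin d → ℝ)) ∂(noiseLaw d η) +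
          3 * (α + β * (d / η)) + β * c) / c := by
  have := isProbabilityMeasure_noiseLaw d hη
  obtain ⟨a, ha⟩ := exists_coord_mem_Icc hΘ i
  have hmove := (hx.integrable_ell1Norm_sub hΘ hη hy).const_mul L
  have herror := (integrable_add_mul_ell1Norm_noiseLaw (d := d) hη α β).const_mul 3
  have hE := (hmove.fun_add herror).fun_add (integrable_const (β * c))
  have h := integral_abs_sub_noiseLaw_le hη hc.le i (hx.measurable_coord i) (hy.measurable_coord i)
    (fun σ => ha (x σ)) (fun σ => ha (y σ)) (hE.div_const c)
    (hx.max_coord_le_min_coord_add_single hc (hx.beta_nonneg hd) hg hy i)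
  rwa [integral_div, integral_add (hmove.fun_add herror) (integrable_const _),
    integral_add hmove herror, integral_const_mul, integral_const_mul,
    integral_add_mul_ell1Norm_noiseLaw hη, integral_const, probReal_univ, one_smul] at h

theorem IsPerturbedLeader.mul_integral_ell1Norm_sub_le (hd : 0 < d) (hL : 0 < L)
    (hΘ : Bornology.IsBounded Θ) (hη : 0 < η) (hg : IsEll1Lipschitz L g)
    (hx : IsPerturbedLeader F α β x) (hy : IsPerturbedLeader (F + g) α β y) :
    L * ∫ σ, ell1Norm ((x σ : Fin d → ℝ) - (y σ : Fin d → ℝ)) ∂(noiseLaw d η) ≤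
      4 * (η * L ^ 2 * d ^ 2 * Metric.diam Θ) + 3 * (α + β * (d / η)) + 2 * (β * L * d) := by
  set Δ := ∫ σ, ell1Norm ((x σ : Fin d → ℝ) - (y σ : Fin d → ℝ)) ∂(noiseLaw d η)
  -- With this shift the displacement reappears on the right with the factor `d * L / c = 1 / 2`.
  obtain ⟨c, hc⟩ : ∃ c, c = 2 * L * d := ⟨_, rfl⟩
  have hc0 : 0 < c := by rw [hc]; positivity
  have hΔ : Δ ≤ d * (η * c * Metric.diam Θ +
      (L * Δ + 3 * (α + β * (d / η)) + β * c) / c) := by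
    calc Δ = ∑ i, ∫ σ, |(x σ : Fin d → ℝ) i - (y σ : Fin d → ℝ) i| ∂(noiseLaw d η) :=
          integral_finsetSum _ fun i _ => hx.integrable_abs_coord_sub hΘ hη hy i
      _ ≤ ∑ _i : Fin d, (η * c * Metric.diam Θ +
            (L * Δ + 3 * (α + β * (d / η)) + β * c) / c) :=
          Finset.sum_le_sum fun i _ => hx.integral_abs_coord_sub_le hd hc0 hΘ hη hg hy i
      _ = _ := by simp [mul_add]
  have hmul := mul_le_mul_of_nonneg_left hΔ hL.le
  have hexpand : L * (d * (η * c * Metric.diam Θ +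
      (L * Δ + 3 * (α + β * (d / η)) + β * c) / c)) =
      2 * (η * L ^ 2 * d ^ 2 * Metric.diam Θ) + (L * Δ + 3 * (α + β * (d / η))) / 2 +
        β * L * d := by
    rw [hc]
    field_simp
    ring
  linarith

/-- The bound on the average regret of follow the perturbed leader over `N` rounds, for
`L`-Lipschitz payoffs on a subset of `ℝ^d` of diameter `D`, noise of rate `η`, and leaders with
errors `α + β ‖σ‖₁`. -/
noncomputable def avgRegretBound (d N : ℕ) (L D α β η : ℝ) : ℝ :=
  4 * (η * L ^ 2 * d ^ 2 * D) + D * d / (η * N) + 5 * (α + β * (d / η)) + 2 * (β * L * d)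

variable {N : ℕ} {f : ℕ → Θ → ℝ} {x : ℕ → (Fin d → ℝ) → Θ}

theorem sum_le_sum_leader_add (hΘ : Bornology.IsBounded Θ)
    (hf : ∀ t < N, IsEll1Lipschitz L (f t))
    (hx : ∀ t ≤ N, IsPerturbedLeader (fun θ => ∑ s ∈ Finset.range t, f s θ) α β (x t))
    (θ : Θ) (σ : Fin d → ℝ) :
    ∑ t ∈ Finset.range N, f t θ ≤
      ∑ t ∈ Finset.range N, (f t (x t σ) +
        L * ell1Norm ((x t σ : Fin d → ℝ) - (x (t + 1) σ : Fin d → ℝ))) +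
      (Metric.diam Θ * ell1Norm σ + (N + 1) * (α + β * ell1Norm σ)) := by
  have hleader := IsApproxMax.add_sum_le_add_sum_succ
    (r := fun θ : Θ => σ ⬝ᵥ (θ : Fin d → ℝ)) (f := f) (x := fun t => x t σ)
    (fun t ht => by simpa only [add_comm] using (hx t ht).isApproxMax σ) θ
  have hnext : ∑ t ∈ Finset.range N, f t (x (t + 1) σ) ≤
      ∑ t ∈ Finset.range N, (f t (x t σ) +
        L * ell1Norm ((x t σ : Fin d → ℝ) - (x (t + 1) σ : Fin d → ℝ))) :=
    Finset.sum_le_sum fun t ht => by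
      linarith [(abs_le.1 (hf t (Finset.mem_range.1 ht) (x t σ) (x (t + 1) σ))).1]
  have hlin : σ ⬝ᵥ (x 0 σ : Fin d → ℝ) - σ ⬝ᵥ (θ : Fin d → ℝ) ≤ Metric.diam Θ * ell1Norm σ := by
    rw [← dotProduct_sub]
    refine (dotProduct_le_norm_mul_ell1Norm _ _).trans
      (mul_le_mul_of_nonneg_right ?_ (ell1Norm_nonneg σ))
    rw [← dist_eq_norm]
    exact Metric.dist_le_diam_of_mem hΘ (x 0 σ).2 θ.2
  linarith

theorem sum_le_sum_integral_leader_add (hη : 0 < η) (hΘ : Bornology.IsBounded Θ)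
    (hf : ∀ t < N, IsEll1Lipschitz L (f t))
    (hx : ∀ t ≤ N, IsPerturbedLeader (fun θ => ∑ s ∈ Finset.range t, f s θ) α β (x t)) (θ : Θ) :
    ∑ t ∈ Finset.range N, f t θ ≤
      ∑ t ∈ Finset.range N, (∫ σ, f t (x t σ) ∂(noiseLaw d η) +
        L * ∫ σ, ell1Norm ((x t σ : Fin d → ℝ) - (x (t + 1) σ : Fin d → ℝ)) ∂(noiseLaw d η)) +
      (Metric.diam Θ * (d / η) + (N + 1) * (α + β * (d / η))) := by
  have := isProbabilityMeasure_noiseLaw d hη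
  have hpayoff (t) (ht : t ∈ Finset.range N) :
      Integrable (fun σ => f t (x t σ)) (noiseLaw d η) := by
    rw [Finset.mem_range] at ht
    exact ((hf t ht).integrable hΘ ((noiseLaw d η).map (x t))).comp_measurable
      (hx t ht.le).measurable
  have hmove (t) (ht : t ∈ Finset.range N) : Integrable (fun σ => L * ell1Norm
      ((x t σ : Fin d → ℝ) - (x (t + 1) σ : Fin d → ℝ))) (noiseLaw d η) := by
    rw [Finset.mem_range] at ht
    exact ((hx t ht.le).integrable_ell1Norm_sub hΘ hη (hx (t + 1) ht)).const_mul L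
  have hround (t) (ht : t ∈ Finset.range N) := (hpayoff t ht).fun_add (hmove t ht)
  have hsum := integrable_finsetSum _ hround
  have hnoise := (integrable_ell1Norm_noiseLaw (d := d) hη).const_mul (Metric.diam Θ)
  have herror := (integrable_add_mul_ell1Norm_noiseLaw (d := d) hη α β).const_mul ((N : ℝ) + 1)
  have h := integral_mono (integrable_const _) (hsum.fun_add (hnoise.fun_add herror))
    (sum_le_sum_leader_add hΘ hf hx θ)
  rw [integral_const, probReal_univ, one_smul, integral_add hsum (hnoise.fun_add herror),
    integral_add hnoise herror, integral_finsetSum _ hround, integral_const_mul,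
    integral_const_mul, integral_ell1Norm_noiseLaw hη, integral_add_mul_ell1Norm_noiseLaw hη] at h
  refine h.trans_eq (congrArg (· + _) (Finset.sum_congr rfl fun t ht => ?_))
  rw [integral_add (hpayoff t ht) (hmove t ht), integral_const_mul]

theorem sum_le_sum_integral_leader_add_avgRegretBound (hd : 0 < d) (hN : 0 < N) (hL : 0 < L)
    (hη : 0 < η) (hΘ : Bornology.IsBounded Θ) (hf : ∀ t < N, IsEll1Lipschitz L (f t))
    (hx : ∀ t ≤ N, IsPerturbedLeader (fun θ => ∑ s ∈ Finset.range t, f s θ) α β (x t)) (θ : Θ) :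
    ∑ t ∈ Finset.range N, f t θ ≤
      ∑ t ∈ Finset.range N, ∫ σ, f t (x t σ) ∂(noiseLaw d η) +
        N * avgRegretBound d N L (Metric.diam Θ) α β η := by
  have herror : 0 ≤ α + β * (d / η) :=
    add_nonneg (hx 0 N.zero_le).alpha_nonneg
      (mul_nonneg ((hx 0 N.zero_le).beta_nonneg hd) (by positivity))
  have hN1 : (1 : ℝ) ≤ N := by exact_mod_cast hN
  have hstable (t) (ht : t ∈ Finset.range N) :
      L * ∫ σ, ell1Norm ((x t σ : Fin d → ℝ) - (x (t + 1) σ : Fin d → ℝ)) ∂(noiseLaw d η) ≤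
        4 * (η * L ^ 2 * d ^ 2 * Metric.diam Θ) + 3 * (α + β * (d / η)) + 2 * (β * L * d) := by
    rw [Finset.mem_range] at ht
    have hnext := hx (t + 1) ht
    simp only [Finset.sum_range_succ] at hnext
    exact (hx t ht.le).mul_integral_ell1Norm_sub_le hd hL hΘ hη (hf t ht) hnext
  calc ∑ t ∈ Finset.range N, f t θ
      ≤ ∑ t ∈ Finset.range N, (∫ σ, f t (x t σ) ∂(noiseLaw d η) +
          (4 * (η * L ^ 2 * d ^ 2 * Metric.diam Θ) + 3 * (α + β * (d / η)) +
            2 * (β * L * d))) + (Metric.diam Θ * (d / η) + 2 * N * (α + β * (d / η))) := by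
        refine (sum_le_sum_integral_leader_add hη hΘ hf hx θ).trans ?_
        gcongr with t ht
        · exact hstable t ht
        · linarith
    _ = _ := by
        rw [Finset.sum_add_distrib, Finset.sum_const, Finset.card_range, nsmul_eq_mul,
          avgRegretBound]
        field_simp
        ring

end PerturbedLeader

variable {d : ℕ}

theorem add_avgRegretBound_le {T : ℕ} {L α α' β D η : ℝ} (hd : 0 < d) (hT : 0 < T) (hL : 0 < L)
    (hα : 0 ≤ α) (hα' : 0 ≤ α') (hβ : 0 ≤ β) (hD : 0 ≤ D)
    (hη : η = √(1 / ((d : ℝ) * L ^ 2 * (T : ℝ)))) :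
    α' + avgRegretBound d T L D α β η ≤
      7 * (D * (d : ℝ) ^ (3 / 2 : ℝ) * L * (T : ℝ) ^ (-(1 / 2) : ℝ) + α + α' +
        β * (d : ℝ) ^ (3 / 2 : ℝ) * L * (T : ℝ) ^ (1 / 2 : ℝ)) := by
  have hs : 1 ≤ √(d : ℝ) := Real.one_le_sqrt.2 (by exact_mod_cast hd)
  have ht : 1 ≤ √(T : ℝ) := Real.one_le_sqrt.2 (by exact_mod_cast hT)
  have hpow : (d : ℝ) ^ (3 / 2 : ℝ) = √d ^ 3 := by
    rw [Real.sqrt_eq_rpow, ← Real.rpow_natCast, ← Real.rpow_mul (by positivity)]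
    norm_num
  have hη' : η = (L * √d * √T)⁻¹ := by
    rw [hη, one_div, Real.sqrt_inv, Real.sqrt_mul (by positivity), Real.sqrt_mul (by positivity),
      Real.sqrt_sq hL.le, mul_comm L]
  have hds : (d : ℝ) = √d ^ 2 := (Real.sq_sqrt (by positivity)).symm
  have hTt : (T : ℝ) = √T ^ 2 := (Real.sq_sqrt (by positivity)).symm
  rw [hpow, Real.rpow_neg (by positivity), ← Real.sqrt_eq_rpow, avgRegretBound, hη']
  generalize √(d : ℝ) = s at *
  generalize √(T : ℝ) = t at *
  rw [hds, hTt]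
  have : 0 < s := by linarith
  have : 0 < t := by linarith
  have hdiam : 0 ≤ D * s ^ 3 * L * t⁻¹ := by positivity
  have hshift : β * L * s ^ 2 ≤ β * s ^ 3 * L * t := by
    have := mul_le_mul_of_nonneg_left (one_le_mul_of_one_le_of_one_le hs ht)
      (by positivity : 0 ≤ β * L * s ^ 2)
    linarith
  have hbound : 4 * ((L * s * t)⁻¹ * L ^ 2 * (s ^ 2) ^ 2 * D) +
      D * s ^ 2 / ((L * s * t)⁻¹ * t ^ 2) + 5 * (α + β * (s ^ 2 / (L * s * t)⁻¹)) =
      5 * (D * s ^ 3 * L * t⁻¹) + 5 * α + 5 * (β * s ^ 3 * L * t) := by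
    field_simp
    ring
  linarith

variable {n : ℕ} {𝒳 : Type*} [MeasurableSpace 𝒳] {G : StatGame d n 𝒳}

theorem RiskLipschitz.isEll1Lipschitz {L : ℝ} (h : G.RiskLipschitz L) (e : G.Estimator) :
    IsEll1Lipschitz L (G.risk e) :=
  h e

theorem RiskLipschitz.integrable_risk {L : ℝ} (h : G.RiskLipschitz L) (e : G.Estimator)
    (P : Measure G.Θ) [IsFiniteMeasure P] : Integrable (G.risk e) P :=
  (h.isEll1Lipschitz e).integrable G.isCompact.isBounded P

theorem RiskLipschitz.bayesRisk_le {L b : ℝ} (h : G.RiskLipschitz L) {e : G.Estimator}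
    (hb : ∀ θ, G.risk e θ ≤ b) (P : Measure G.Θ) [IsProbabilityMeasure P] :
    G.bayesRisk e P ≤ b := by
  simpa [bayesRisk] using integral_mono (h.integrable_risk e P) (integrable_const b) hb

section Oracle

variable {α α' β : ℝ} {N : ℕ} {maxO : List G.Estimator → (Fin d → ℝ) → G.Θ}
  {minO : Measure G.Θ → G.Estimator}

theorem IsMaxOracle.isPerturbedLeader (h : G.IsMaxOracle α β N maxO) {l : List G.Estimator}
    (hl : l.length ≤ N) :
    IsPerturbedLeader (fun θ => (l.map fun e => G.risk e θ).sum) α β (maxO l) :=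
  ⟨(h l hl).1, fun σ θ => sub_le_iff_le_add.1 ((h l hl).2 σ θ)⟩

theorem IsMinOracle.error_nonneg (h : G.IsMinOracle α' minO) : 0 ≤ α' := by
  obtain ⟨m, hm⟩ := G.nonempty
  have := h (Measure.dirac ⟨m, hm⟩) inferInstance (minO (Measure.dirac ⟨m, hm⟩))
  linarith

theorem IsMinOracle.risk_sub_le_risk (h : G.IsMinOracle α' minO) (θ : G.Θ) (e : G.Estimator) :
    G.risk (minO (Measure.dirac θ)) θ - α' ≤ G.risk e θ := by
  have hdirac := h (Measure.dirac θ) inferInstance e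
  rw [bayesRisk, bayesRisk, integral_dirac, integral_dirac] at hdirac
  linarith

end Oracle

section Randomized

variable [MeasurableSpace G.Estimator] {θ : G.Θ} {μ : Measure G.Estimator}

theorem randRisk_eq_integral (h : Integrable (fun e => G.risk e θ) μ) :
    G.randRisk μ θ = ((∫ e, G.risk e θ ∂μ : ℝ) : EReal) := by
  rw [integral_eq_lintegral_pos_part_sub_lintegral_neg_part h, randRisk, EReal.coe_sub,
    EReal.coe_ennreal_toReal h.lintegral_lt_top.ne,
    EReal.coe_ennreal_toReal h.fun_neg.lintegral_lt_top.ne]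

theorem integrable_risk_of_randRisk_ne_top [IsFiniteMeasure μ]
    (hmeas : Measurable fun e => G.risk e θ) {b : ℝ} (hb : ∀ e, b ≤ G.risk e θ)
    (h : G.randRisk μ θ ≠ ⊤) : Integrable (fun e => G.risk e θ) μ := by
  have hneg : ∫⁻ e, ENNReal.ofReal (-(G.risk e θ)) ∂μ ≠ ⊤ := by
    refine ne_top_of_le_ne_top ?_
      (lintegral_mono fun e => ENNReal.ofReal_le_ofReal (neg_le_neg (hb e)))
    simpa using ENNReal.mul_ne_top ENNReal.ofReal_ne_top (measure_ne_top μ _)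
  have hpos : ∫⁻ e, ENNReal.ofReal (G.risk e θ) ∂μ ≠ ⊤ := fun htop => h <| by
    rw [randRisk, htop, EReal.coe_ennreal_top]
    exact EReal.top_sub (by simpa using hneg)
  have hshift : Integrable (fun e => G.risk e θ - b) μ := by
    rw [← lintegral_ofReal_ne_top_iff_integrable (hmeas.sub_const b).aestronglyMeasurable
      (ae_of_all _ fun e => sub_nonneg.2 (hb e))]
    refine ne_top_of_le_ne_top ?_ (lintegral_mono fun e =>
      (congrArg ENNReal.ofReal (sub_eq_add_neg _ _)).trans_le ENNReal.ofReal_add_le)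
    rw [lintegral_add_left hmeas.ennreal_ofReal]
    exact ENNReal.add_ne_top.2 ⟨hpos, by simp [ENNReal.mul_eq_top]⟩
  simpa using hshift.fun_add (integrable_const b)

theorem RiskLipschitz.integrable_prod {L : ℝ} (h : G.RiskLipschitz L)
    (hmeas : ∀ θ : G.Θ, Measurable fun e : G.Estimator => G.risk e θ) [IsFiniteMeasure μ]
    (hint : Integrable (fun e => G.risk e θ) μ) (P : Measure G.Θ) [IsFiniteMeasure P] :
    Integrable (Function.uncurry fun (θ : G.Θ) (e : G.Estimator) => G.risk e θ) (P.prod μ) := by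
  have hjoint : StronglyMeasurable
      (Function.uncurry fun (θ : G.Θ) (e : G.Estimator) => G.risk e θ) :=
    stronglyMeasurable_uncurry_of_continuous_of_stronglyMeasurable
      (fun e => (h.isEll1Lipschitz e).lipschitzWith.continuous)
      fun θ => (hmeas θ).stronglyMeasurable
  have : BoundedSpace G.Θ := boundedSpace_subtype_iff.2 G.isCompact.isBounded
  have hbound := (hint.norm.add
    (integrable_const ((‖L‖₊ * d : NNReal) * Metric.diam (Set.univ : Set G.Θ)))).comp_snd P
  refine hbound.mono' hjoint.aestronglyMeasurable (ae_of_all _ fun p => ?_)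
  calc ‖G.risk p.2 p.1‖
      ≤ ‖G.risk p.2 θ‖ + dist (G.risk p.2 p.1) (G.risk p.2 θ) :=
        norm_le_norm_add_norm_sub' _ _
    _ ≤ ‖G.risk p.2 θ‖ + (‖L‖₊ * d : NNReal) * Metric.diam (Set.univ : Set G.Θ) := by
        gcongr
        refine ((h.isEll1Lipschitz p.2).lipschitzWith.dist_le_mul p.1 θ).trans ?_
        gcongr
        exact Metric.dist_le_diam_of_mem (Bornology.IsBounded.all _) (Set.mem_univ _)
          (Set.mem_univ _)

theorem le_iSup_randRisk {L v : ℝ} (hLip : G.RiskLipschitz L)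
    (hmeas : ∀ θ : G.Θ, Measurable fun e : G.Estimator => G.risk e θ)
    (hbelow : ∀ θ : G.Θ, ∃ b, ∀ e, b ≤ G.risk e θ) (P : Measure G.Θ) [IsProbabilityMeasure P]
    (hv : ∀ e, v ≤ G.bayesRisk e P) [IsProbabilityMeasure μ] :
    (v : EReal) ≤ ⨆ θ : G.Θ, G.randRisk μ θ := by
  have hle : ∀ θ, G.randRisk μ θ ≤ ⨆ θ, G.randRisk μ θ := le_iSup _
  rcases eq_or_ne (⨆ θ, G.randRisk μ θ) ⊤ with htop | htop
  · rw [htop]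
    exact le_top
  have hint (θ : G.Θ) : Integrable (fun e => G.risk e θ) μ :=
    (hbelow θ).elim fun b hb => integrable_risk_of_randRisk_ne_top (hmeas θ) hb
      (ne_top_of_le_ne_top htop (hle θ))
  obtain ⟨m, hm⟩ := G.nonempty
  have hprod := hLip.integrable_prod hmeas (hint ⟨m, hm⟩) P
  have hlow : v ≤ ∫ e, G.bayesRisk e P ∂μ := by
    simpa [bayesRisk] using integral_mono (integrable_const v) hprod.integral_prod_right hv
  obtain ⟨θ, hθ⟩ : ∃ θ, ∫ e, G.bayesRisk e P ∂μ ≤ ∫ e, G.risk e θ ∂μ := by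
    simp only [bayesRisk]
    rw [← integral_integral_swap hprod]
    exact exists_integral_le hprod.integral_prod_left
  refine le_trans ?_ (hle θ)
  rw [randRisk_eq_integral (hint θ), EReal.coe_le_coe_iff]
  exact hlow.trans hθ

theorem minimaxRisk_le_iSup_randRisk (μ : Measure G.Estimator) [hμ : IsProbabilityMeasure μ] :
    G.minimaxRisk ≤ ⨆ θ : G.Θ, G.randRisk μ θ :=
  iInf_le (fun μ : ProbabilityMeasure G.Estimator =>
    ⨆ θ : G.Θ, G.randRisk (μ : Measure G.Estimator) θ) ⟨μ, hμ⟩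

end Randomized

section Iterates

variable {L α β α' η : ℝ} {T : ℕ} {maxO : List G.Estimator → (Fin d → ℝ) → G.Θ}
  {minO : Measure G.Θ → G.Estimator}

theorem history_eq_map_range (t : ℕ) :
    G.history maxO minO η t = (List.range t).map (G.iterate maxO minO η) := by
  induction t with
  | zero => rfl
  | succ t ih =>
    rw [history, List.range_succ, List.map_append, ← ih]
    rfl

theorem IsMaxOracle.isPerturbedLeader_history (h : G.IsMaxOracle α β T maxO) {t : ℕ}
    (ht : t ≤ T) :
    IsPerturbedLeader (fun θ => ∑ s ∈ Finset.range t, G.risk (G.iterate maxO minO η s) θ) α β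
      (maxO (G.history maxO minO η t)) := by
  convert h.isPerturbedLeader (l := G.history maxO minO η t) ?_ using 2
  · rw [history_eq_map_range, List.map_map]
    rfl
  · rwa [history_eq_map_range, List.length_map, List.length_range]

theorem isProbabilityMeasure_prior (hη : 0 < η) (hmax : G.IsMaxOracle α β T maxO) {t : ℕ}
    (ht : t ≤ T) : IsProbabilityMeasure (G.prior maxO minO η t) := by
  have := isProbabilityMeasure_noiseLaw d hη
  exact Measure.isProbabilityMeasure_map (hmax.isPerturbedLeader_history ht).measurable.aemeasurable

theorem bayesRisk_prior (hLip : G.RiskLipschitz L) (hmax : G.IsMaxOracle α β T maxO) {t : ℕ}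
    (ht : t ≤ T) (e : G.Estimator) :
    G.bayesRisk e (G.prior maxO minO η t) =
      ∫ σ, G.risk e (maxO (G.history maxO minO η t) σ) ∂(noiseLaw d η) :=
  integral_map (hmax.isPerturbedLeader_history ht).measurable.aemeasurable
    (hLip.isEll1Lipschitz e).lipschitzWith.continuous.aestronglyMeasurable

theorem isProbabilityMeasure_avgPrior (hT : 0 < T) (hη : 0 < η)
    (hmax : G.IsMaxOracle α β T maxO) : IsProbabilityMeasure (G.avgPrior maxO minO η T) :=
  isProbabilityMeasure_inv_smul_sum_range hT fun _ ht => isProbabilityMeasure_prior hη hmax ht.le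

theorem bayesRisk_avgPrior (hLip : G.RiskLipschitz L) (hη : 0 < η)
    (hmax : G.IsMaxOracle α β T maxO) (e : G.Estimator) :
    G.bayesRisk e (G.avgPrior maxO minO η T) =
      (T : ℝ)⁻¹ * ∑ t ∈ Finset.range T, G.bayesRisk e (G.prior maxO minO η t) := by
  refine integral_inv_smul_sum_range fun t ht => ?_
  have := isProbabilityMeasure_prior (minO := minO) hη hmax ht.le
  exact hLip.integrable_risk e _

/-- The average payoff `(R(e_1, P_1) + ⋯ + R(e_T, P_T)) / T` of the repeated game, which
approximates its value. -/
noncomputable def avgPayoff (G : StatGame d n 𝒳) (maxO : List G.Estimator → (Fin d → ℝ) → G.Θ)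
    (minO : Measure G.Θ → G.Estimator) (η : ℝ) (T : ℕ) : ℝ :=
  (T : ℝ)⁻¹ * ∑ t ∈ Finset.range T, G.bayesRisk (G.iterate maxO minO η t) (G.prior maxO minO η t)

theorem avgPayoff_le_bayesRisk_avgPrior_add (hT : 0 < T) (hLip : G.RiskLipschitz L) (hη : 0 < η)
    (hmax : G.IsMaxOracle α β T maxO) (hmin : G.IsMinOracle α' minO) (e : G.Estimator) :
    G.avgPayoff maxO minO η T ≤ G.bayesRisk e (G.avgPrior maxO minO η T) + α' := by
  have hT0 : (T : ℝ) ≠ 0 := by exact_mod_cast hT.ne'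
  calc G.avgPayoff maxO minO η T
      ≤ (T : ℝ)⁻¹ * ∑ t ∈ Finset.range T, (G.bayesRisk e (G.prior maxO minO η t) + α') := by
        refine mul_le_mul_of_nonneg_left (Finset.sum_le_sum fun t ht => ?_) (by positivity)
        exact hmin _ (isProbabilityMeasure_prior hη hmax (Finset.mem_range.1 ht).le) e
    _ = G.bayesRisk e (G.avgPrior maxO minO η T) + α' := by
        rw [bayesRisk_avgPrior hLip hη hmax, Finset.sum_add_distrib, mul_add]
        simp [hT0]

theorem inv_mul_sum_risk_iterate_le (hd : 0 < d) (hT : 0 < T) (hL : 0 < L)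
    (hLip : G.RiskLipschitz L) (hη : 0 < η) (hmax : G.IsMaxOracle α β T maxO) (θ : G.Θ) :
    (T : ℝ)⁻¹ * ∑ t ∈ Finset.range T, G.risk (G.iterate maxO minO η t) θ ≤
      G.avgPayoff maxO minO η T + avgRegretBound d T L (Metric.diam G.Θ) α β η := by
  have hT0 : (T : ℝ) ≠ 0 := by exact_mod_cast hT.ne'
  have hregret := sum_le_sum_integral_leader_add_avgRegretBound hd hT hL hη G.isCompact.isBounded
    (fun t _ => hLip.isEll1Lipschitz (G.iterate maxO minO η t))
    (fun t ht => hmax.isPerturbedLeader_history ht) θ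
  calc (T : ℝ)⁻¹ * ∑ t ∈ Finset.range T, G.risk (G.iterate maxO minO η t) θ
      ≤ (T : ℝ)⁻¹ * (∑ t ∈ Finset.range T,
          ∫ σ, G.risk (G.iterate maxO minO η t) (maxO (G.history maxO minO η t) σ)
            ∂(noiseLaw d η) + T * avgRegretBound d T L (Metric.diam G.Θ) α β η) :=
        mul_le_mul_of_nonneg_left hregret (by positivity)
    _ = G.avgPayoff maxO minO η T + avgRegretBound d T L (Metric.diam G.Θ) α β η := by
        rw [mul_add, inv_mul_cancel_left₀ hT0, avgPayoff, Finset.sum_congr rfl fun t ht =>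
          bayesRisk_prior hLip hmax (Finset.mem_range.1 ht).le _]

theorem isProbabilityMeasure_rndEstimator [MeasurableSpace G.Estimator] (hT : 0 < T) :
    IsProbabilityMeasure (G.rndEstimator maxO minO η T) :=
  isProbabilityMeasure_inv_smul_sum_range hT fun _ _ => inferInstance

theorem randRisk_rndEstimator [MeasurableSpace G.Estimator] (hT : 0 < T) {θ : G.Θ}
    (hmeas : Measurable fun e : G.Estimator => G.risk e θ) :
    G.randRisk (G.rndEstimator maxO minO η T) θ =
      (((T : ℝ)⁻¹ * ∑ t ∈ Finset.range T, G.risk (G.iterate maxO minO η t) θ : ℝ) : EReal) := by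
  have hdirac (t : ℕ) :
      Integrable (fun e => G.risk e θ) (Measure.dirac (G.iterate maxO minO η t)) :=
    integrable_dirac' hmeas.stronglyMeasurable (by simp)
  have hint : Integrable (fun e => G.risk e θ) (G.rndEstimator maxO minO η T) :=
    (integrable_finsetSum_measure.2 fun t _ => hdirac t).smul_measure
      (ENNReal.inv_ne_top.2 (by exact_mod_cast hT.ne'))
  rw [randRisk_eq_integral hint, rndEstimator, integral_inv_smul_sum_range fun t _ => hdirac t]
  simp only [integral_dirac' _ _ hmeas.stronglyMeasurable]

theorem risk_avgEstimator_le (hrisk : G.HasRisk) (hT : 0 < T) (hΘ : Convex ℝ G.Θ) {θ : G.Θ}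
    (hconv : ConvexOn ℝ G.Θ fun a => G.loss a θ) :
    G.risk (G.avgEstimator maxO minO η hΘ T hT) θ ≤
      (T : ℝ)⁻¹ * ∑ t ∈ Finset.range T, G.risk (G.iterate maxO minO η t) θ := by
  have hT0 : (T : ℝ) ≠ 0 := by exact_mod_cast hT.ne'
  have hint (t : ℕ) : Integrable
      (fun x => (T : ℝ)⁻¹ * G.loss ((G.iterate maxO minO η t).toFun x) θ) (G.sampleLaw θ) :=
    (hrisk _ θ).const_mul _
  calc G.risk (G.avgEstimator maxO minO η hΘ T hT) θ
      ≤ ∫ x, ∑ t ∈ Finset.range T,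
          (T : ℝ)⁻¹ * G.loss ((G.iterate maxO minO η t).toFun x) θ ∂(G.sampleLaw θ) := by
        refine integral_mono (hrisk _ θ) (integrable_finsetSum _ fun t _ => hint t) fun x => ?_
        exact hconv.map_sum_le (t := Finset.range T) (w := fun _ => (T : ℝ)⁻¹)
          (fun _ _ => by positivity) (by simp [hT0]) fun t _ => Subtype.coe_prop _
    _ = _ := by
        rw [integral_finsetSum _ fun t _ => hint t, Finset.mul_sum]
        simp only [integral_const_mul, risk]

end Iterates

end StatGame

theorem corollary3_general {d n T : ℕ} (hd : 0 < d) (hT : 0 < T) {𝒳 : Type*} [MeasurableSpace 𝒳]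
    {G : StatGame d n 𝒳} [MeasurableSpace G.Estimator] {L α β α' η ε : ℝ}
    {maxO : List G.Estimator → (Fin d → ℝ) → G.Θ} {minO : Measure G.Θ → G.Estimator}
    (hrisk : G.HasRisk) (hmeas : ∀ θ : G.Θ, Measurable fun e : G.Estimator => G.risk e θ)
    (hL : 0 < L) (hLip : G.RiskLipschitz L) (hmax : G.IsMaxOracle α β T maxO)
    (hmin : G.IsMinOracle α' minO) (hη : 0 < η)
    (hε : α' + StatGame.avgRegretBound d T L (Metric.diam G.Θ) α β η ≤ ε) :
    (⨆ θ : G.Θ, G.randRisk (G.rndEstimator maxO minO η T) θ) ≤ G.minimaxRisk + (ε : EReal) ∧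
    G.minimaxRisk - (ε : EReal) ≤
      (⨅ e : G.Estimator, (G.bayesRisk e (G.avgPrior maxO minO η T) : EReal)) ∧
    ∀ hΘ : Convex ℝ G.Θ, (∀ θ : G.Θ, ConvexOn ℝ G.Θ (fun a => G.loss a θ)) →
      (⨆ θ : G.Θ, (G.risk (G.avgEstimator maxO minO η hΘ T hT) θ : EReal)) ≤
          G.minimaxRisk + (ε : EReal) ∧
      (G.bayesRisk (G.avgEstimator maxO minO η hΘ T hT) (G.avgPrior maxO minO η T) : EReal) ≤
        (⨅ e : G.Estimator, (G.bayesRisk e (G.avgPrior maxO minO η T) : EReal)) + (ε : EReal) := by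
  obtain ⟨w, hw⟩ : ∃ w, w = G.avgPayoff maxO minO η T - α' := ⟨_, rfl⟩
  have hupper (θ : G.Θ) :
      (T : ℝ)⁻¹ * ∑ t ∈ Finset.range T, G.risk (G.iterate maxO minO η t) θ ≤ w + ε := by
    linarith [StatGame.inv_mul_sum_risk_iterate_le (minO := minO) hd hT hL hLip hη hmax θ]
  have hlower (e : G.Estimator) : w ≤ G.bayesRisk e (G.avgPrior maxO minO η T) := by
    linarith [StatGame.avgPayoff_le_bayesRisk_avgPrior_add hT hLip hη hmax hmin e]
  have := StatGame.isProbabilityMeasure_avgPrior (minO := minO) hT hη hmax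
  have := StatGame.isProbabilityMeasure_rndEstimator (G := G) (maxO := maxO) (minO := minO)
    (η := η) hT
  have hrnd : (⨆ θ : G.Θ, G.randRisk (G.rndEstimator maxO minO η T) θ) ≤ ((w + ε : ℝ) : EReal) :=
    iSup_le fun θ => (StatGame.randRisk_rndEstimator hT (hmeas θ)).trans_le
      (EReal.coe_le_coe_iff.2 (hupper θ))
  have hminimax : ((w + ε : ℝ) : EReal) ≤ G.minimaxRisk + (ε : EReal) :=
    (EReal.coe_add w ε).trans_le <| add_le_add_left (le_iInf fun μ =>
      StatGame.le_iSup_randRisk hLip hmeas (fun θ => ⟨_, hmin.risk_sub_le_risk θ⟩) _ hlower) _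
  have hBayes : ((w + ε : ℝ) : EReal) ≤
      (⨅ e : G.Estimator, (G.bayesRisk e (G.avgPrior maxO minO η T) : EReal)) + (ε : EReal) :=
    (EReal.coe_add w ε).trans_le <|
      add_le_add_left (le_iInf fun e => EReal.coe_le_coe_iff.2 (hlower e)) _
  refine ⟨hrnd.trans hminimax, ?_, fun hΘ hconv => ?_⟩
  · exact EReal.sub_le_of_le_add
      ((StatGame.minimaxRisk_le_iSup_randRisk _).trans (hrnd.trans hBayes))
  · have havg (θ : G.Θ) : G.risk (G.avgEstimator maxO minO η hΘ T hT) θ ≤ w + ε :=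
      (StatGame.risk_avgEstimator_le hrisk hT hΘ (hconv θ)).trans (hupper θ)
    exact ⟨(iSup_le fun θ => EReal.coe_le_coe_iff.2 (havg θ)).trans hminimax,
      (EReal.coe_le_coe_iff.2 (hLip.bayesRisk_le havg _)).trans hBayes⟩

theorem corollary3 :
    ∃ C : ℝ, 0 < C ∧
      ∀ (d n T : ℕ) (_hd : 0 < d) (hT : 0 < T)
        (𝒳 : Type*) [MeasurableSpace 𝒳] (G : StatGame d n 𝒳)
        [MeasurableSpace G.Estimator]
        (L α β α' η ε : ℝ)
        (maxO : List G.Estimator → (Fin d → ℝ) → G.Θ)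
        (minO : Measure G.Θ → G.Estimator),
        -- the setting
        G.HasRisk →
        (∀ θ : G.Θ, Measurable (fun e : G.Estimator => G.risk e θ)) →
        0 < L →
        G.RiskLipschitz L →
        G.IsMaxOracle α β T maxO →
        G.IsMinOracle α' minO →
        η = √(1 / ((d : ℝ) * L ^ 2 * (T : ℝ))) →
        -- the error; `Metric.diam` is the diameter in the sup norm
        ε = C * (Metric.diam G.Θ * (d : ℝ) ^ (3 / 2 : ℝ) * L * (T : ℝ) ^ (-(1 / 2) : ℝ)
              + α + α' + β * (d : ℝ) ^ (3 / 2 : ℝ) * L * (T : ℝ) ^ (1 / 2 : ℝ)) →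
        -- worst-case risk of the randomized estimator
        (⨆ θ : G.Θ, G.randRisk (G.rndEstimator maxO minO η T) θ) ≤ G.minimaxRisk + (ε : EReal) ∧
        -- Bayes risk of the average prior
        G.minimaxRisk - (ε : EReal) ≤
          (⨅ e : G.Estimator, (G.bayesRisk e (G.avgPrior maxO minO η T) : EReal)) ∧
        -- convex losses: worst-case and Bayes risk of the averaged estimator
        ∀ hΘ : Convex ℝ G.Θ, (∀ θ : G.Θ, ConvexOn ℝ G.Θ (fun a => G.loss a θ)) →
          (⨆ θ : G.Θ, (G.risk (G.avgEstimator maxO minO η hΘ T hT) θ : EReal)) ≤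
              G.minimaxRisk + (ε : EReal) ∧
          (G.bayesRisk (G.avgEstimator maxO minO η hΘ T hT) (G.avgPrior maxO minO η T) : EReal) ≤
            (⨅ e : G.Estimator, (G.bayesRisk e (G.avgPrior maxO minO η T) : EReal))
              + (ε : EReal) := by
  refine ⟨7, by norm_num, ?_⟩
  intro d n T hd hT 𝒳 _ G _ L α β α' η ε maxO minO hrisk hmeas hL hLip hmax hmin hη hε
  have hleader := hmax.isPerturbedLeader (l := []) T.zero_le
  refine corollary3_general hd hT hrisk hmeas hL hLip hmax hmin (by rw [hη]; positivity) ?_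
  exact (StatGame.add_avgRegretBound_le hd hT hL hleader.alpha_nonneg hmin.error_nonneg
    (hleader.beta_nonneg hd) Metric.diam_nonneg hη).trans_eq hε.symm
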